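/- Let $\kappa<\mathfrak c$ be a cardinal number for which $\mathsf{MA}(\kappa)$ holds, that is: for every nonempty partially ordered set $\mathbb P$ in which every uncountable subset contains two distinct elements with a common upper bound in $\mathbb P$, and for every family $\{\mathbb D_\xi:\xi<\kappa\}$ of subsets of $\mathbb P$ that are dense (every $p\in\mathbb P$ lies below some $d\in\mathbb D_\xi$), there is a set $\mathbb G\subseteq\mathbb P$, any two elements of which have an upper bound in $\mathbb G$, such that $\mathbb G\cap\mathbb D_\xi\neq\emptyset$ for every $\xi<\kappa$. Let $\mathcal A$ be an almost disjoint family of subsets of $\omega$ (any two distinct members of $\mathcal A$ have finite intersection) with $|\mathcal A|=\kappa$. Let $\mathfrak A$ be the algebra of subsets of $\omega$ generated by $\mathcal A$ and all finite subsets of $\omega$, and let $K$ be the Stone space of $\mathfrak A$, that is, the compact Hausdorff space of all ultrafilters on $\mathfrak A$. Let $C(K)$ be the Banach space of continuous real-valued functions on $K$ with the supremum norm, let $M(K)=C(K)^*$ be the space of signed Radon measures on $K$ of finite variation, and let $M_1(K)$ be its closed unit ball with the weak$^*$ topology. Then: 1. $K$ has the $^*$extension property: for every compact Hausdorff space $L'\supseteq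 M_1(K)$ (containing $M_1(K)$ as a topological subspace) such that $L'\setminus M_1(K)$ is countable and, as a subspace, discrete, there is a bounded linear operator $E:C(K)\to C(L')$ with $Eg(\nu)=\nu(g)$ for all $g\in C(K)$ and $\nu\in M_1(K)$. 2. Every twisted sum of $c_0$ and $C(K)$ is trivial: for every real Banach space $X$ and every short exact sequence $0\to c_0\xrightarrow{\,i\,}X\xrightarrow{\,q\,}C(K)\to 0$ of bounded linear maps, there is a bounded linear operator $r:X\to c_0$ with $r\circ i=\mathrm{id}_{c_0}$. -/

import Mathlib

open Set Filter Topology Cardinal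
open scoped ZeroAtInfty

namespace TwistedSums

/-! ### Martin's axiom -/

/-- A subset `D` of `P` is dense (upwards): every condition has an upper bound in `D`. -/
def IsDenseUp {P : Type*} [PartialOrder P] (D : Set P) : Prop :=
  ∀ p : P, ∃ d ∈ D, p ≤ d

/-- The countable chain condition (upwards): every uncountable set of conditions contains two
distinct conditions with a common upper bound in `P`. -/
def IsCCC (P : Type*) [PartialOrder P] : Prop :=
  ∀ S : Set P, ¬ S.Countable → ∃ p ∈ S, ∃ p' ∈ S, p ≠ p' ∧ ∃ q : P, p ≤ q ∧ p' ≤ q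

/-- Martin's axiom `MA(κ)`: for every nonempty ccc partially ordered set `P` and every family of
`κ` dense subsets of `P` there is a directed subset of `P` meeting all of them. -/
def MartinAxiom.{u} (κ : Cardinal.{u}) : Prop :=
  ∀ (P : Type u) [PartialOrder P] [Nonempty P], IsCCC P →
    ∀ (I : Type u), #I = κ → ∀ D : I → Set P, (∀ ξ, IsDenseUp (D ξ)) →
      ∃ G : Set P, DirectedOn (· ≤ ·) G ∧ ∀ ξ, (G ∩ D ξ).Nonempty

/-! ### Almost disjoint families and the algebras they generate -/

/-- A family of subsets of `ℕ` is almost disjoint if any two distinct members have finite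
intersection. -/
def AlmostDisjoint (𝒜 : Set (Set ℕ)) : Prop :=
  𝒜.Pairwise fun A B => (A ∩ B).Finite

/-- The algebra of subsets of `ℕ` generated by `𝒜` and all finite subsets of `ℕ`. -/
def generatedAlgebra (𝒜 : Set (Set ℕ)) : BooleanSubalgebra (Set ℕ) :=
  BooleanSubalgebra.closure (𝒜 ∪ {F | F.Finite})

/-! ### The Stone space of a Boolean algebra -/

/-- The ultrafilters of a Boolean algebra `B`. -/
@[ext]
structure StoneSpace (B : Type*) [BooleanAlgebra B] where
  /-- The set of elements of the ultrafilter. -/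
  carrier : Set B
  top_mem : ⊤ ∈ carrier
  bot_notMem : ⊥ ∉ carrier
  mem_of_le : ∀ {a b : B}, a ∈ carrier → a ≤ b → b ∈ carrier
  inf_mem : ∀ {a b : B}, a ∈ carrier → b ∈ carrier → a ⊓ b ∈ carrier
  mem_or_compl_mem : ∀ a : B, a ∈ carrier ∨ aᶜ ∈ carrier

namespace StoneSpace

variable {B : Type*} [BooleanAlgebra B]

/-- The basic set of all ultrafilters that contain `a`. -/
def basic (a : B) : Set (StoneSpace B) := {x | a ∈ x.carrier}

/-- The Stone topology, generated by the sets `basic a`. -/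
instance : TopologicalSpace (StoneSpace B) :=
  TopologicalSpace.generateFrom (Set.range basic)

theorem isOpen_basic (a : B) : IsOpen (basic a) :=
  TopologicalSpace.isOpen_generateFrom_of_mem ⟨a, rfl⟩

theorem compl_mem_iff (x : StoneSpace B) (a : B) : aᶜ ∈ x.carrier ↔ a ∉ x.carrier := by
  refine ⟨fun h h' => x.bot_notMem ?_, fun h => (x.mem_or_compl_mem a).resolve_left h⟩
  simpa using x.inf_mem h' h

instance : CompactSpace (StoneSpace B) := by
  refine ⟨isCompact_iff_ultrafilter_le_nhds.2 fun U _ => ?_⟩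
  refine ⟨⟨{a | ∀ᶠ x in (U : Filter (StoneSpace B)), a ∈ x.carrier}, ?_, ?_, ?_, ?_, ?_⟩,
    mem_univ _, ?_⟩
  · exact Eventually.of_forall fun x => x.top_mem
  · intro h
    obtain ⟨x, hx⟩ := h.exists
    exact x.bot_notMem hx
  · intro a b ha hab
    exact Eventually.mono ha fun x hx => x.mem_of_le hx hab
  · intro a b ha hb
    filter_upwards [ha, hb] with x h1 h2 using x.inf_mem h1 h2
  · intro a
    simp only [Set.mem_ofPred_eq, compl_mem_iff]
    exact Ultrafilter.eventually_or.1 (Eventually.of_forall fun x => em _)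
  · rw [TopologicalSpace.nhds_generateFrom]
    refine le_iInf₂ fun s hs => ?_
    obtain ⟨h1, a, rfl⟩ := hs
    exact le_principal_iff.2 h1

instance : T2Space (StoneSpace B) := by
  refine ⟨fun x y hxy => ?_⟩
  have key : ∃ a, ¬ (a ∈ x.carrier ↔ a ∈ y.carrier) := by
    by_contra! h
    exact hxy (StoneSpace.ext (Set.ext h))
  obtain ⟨a, ha⟩ := key
  have disj : Disjoint (basic a) (basic aᶜ) :=
    Set.disjoint_left.2 fun z h1 h2 => (compl_mem_iff z a).1 h2 h1
  by_cases hx : a ∈ x.carrier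
  · exact ⟨basic a, basic aᶜ, isOpen_basic _, isOpen_basic _, hx,
      (compl_mem_iff y a).2 fun hy => ha (by simp [hx, hy]), disj⟩
  · exact ⟨basic aᶜ, basic a, isOpen_basic _, isOpen_basic _, (compl_mem_iff x a).2 hx,
      by by_contra hy; exact ha (iff_of_false hx hy), disj.symm⟩

end StoneSpace

/-! ### The *extension property -/

/-- `ι : L → L'` exhibits the compact Hausdorff space `L'` as a countable discrete extension of
`L`: it is a topological embedding and the complement of its range, with the subspace topology,
is countable and discrete. -/
structure IsCountableDiscreteExtension {L L' : Type*} [TopologicalSpace L] [TopologicalSpace L']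
    [CompactSpace L'] [T2Space L'] (ι : L → L') : Prop where
  isEmbedding : IsEmbedding ι
  countable_compl : ((range ι)ᶜ).Countable
  discrete_compl : DiscreteTopology ((range ι)ᶜ : Set L')

/-- `M₁(K)`: the closed unit ball of `M(K) = C(K)*` with the weak* topology. The signed Radon
measure `ν` is identified with the functional `g ↦ ν(g) = ∫ g dν`, so that the total variation
norm is the dual norm. -/
abbrev UnitBallM (K : Type*) [TopologicalSpace K] [CompactSpace K] : Type _ :=
  {ν : WeakDual ℝ C(K, ℝ) // ‖WeakDual.toStrongDual ν‖ ≤ 1}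

/-- The *extension property of a compact space `K`: for every countable discrete extension `L'` of
`M₁(K)` there is a bounded linear operator `E : C(K) → C(L')` with `E g (ν) = ν(g)` for all
`g ∈ C(K)` and `ν ∈ M₁(K)`. -/
def StarExtensionProperty.{u, v} (K : Type u) [TopologicalSpace K] [CompactSpace K] : Prop :=
  ∀ (L' : Type v) [TopologicalSpace L'] [CompactSpace L'] [T2Space L'] (ι : UnitBallM K → L'),
    IsCountableDiscreteExtension ι →
      ∃ E : C(K, ℝ) →L[ℝ] C(L', ℝ), ∀ (g : C(K, ℝ)) (ν : UnitBallM K), E g (ι ν) = ν.1 g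

/-! ### Twisted sums -/

section

variable {Z X Y : Type*} [NormedAddCommGroup Z] [NormedSpace ℝ Z]
  [NormedAddCommGroup X] [NormedSpace ℝ X] [NormedAddCommGroup Y] [NormedSpace ℝ Y]

/-- `0 → Z → X → Y → 0`, with bounded linear maps `i` and `q`, is a short exact sequence. For
Banach spaces this says that `X` is a twisted sum of `Z` and `Y`. -/
structure IsTwistedSum (i : Z →L[ℝ] X) (q : X →L[ℝ] Y) : Prop where
  injective : Function.Injective i
  exact : Function.Exact i q
  surjective : Function.Surjective q

/-- The exact sequence splits: `Z → X` has a bounded linear left inverse. -/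
def Splits (i : Z →L[ℝ] X) : Prop :=
  ∃ r : X →L[ℝ] Z, ∀ z, r (i z) = z

end

/-- Every twisted sum of `c₀` and `C(K)` is trivial. Here `C₀(ℕ, ℝ)`, with `ℕ` discrete and the
supremum norm, is the space `c₀` of real sequences that tend to zero. -/
def AllTwistedSumsTrivial.{u, w} (K : Type u) [TopologicalSpace K] [CompactSpace K] : Prop :=
  ∀ (X : Type w) [NormedAddCommGroup X] [NormedSpace ℝ X] [CompleteSpace X]
    (i : C₀(ℕ, ℝ) →L[ℝ] X) (q : X →L[ℝ] C(K, ℝ)), IsTwistedSum i q → Splits i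

end TwistedSums

universe v w

namespace TwistedSums

/-! Both conclusions follow from one lifting property, `HasLifts C(K)`: every bounded operator from
`C(K)` to `ℓ_∞ / c₀` lifts to `ℓ_∞`. An operator into the quotient is handled as a bounded map `φ`
into `ℓ_∞` that is linear modulo `c₀`. Such maps arise from norm-controlled nonlinear choices:
Tietze extensions for the *extension property (`starExtensionProperty_of_hasLifts`), and a bounded
section of the quotient map for twisted sums (`IsTwistedSum.splits_of_hasLifts`).

To lift `φ` (`hasLifts_stoneSpace`), first subtract functionals that agree with `φ` modulo `c₀` on
the constants and on the isolated points of `ℕ`; this is Sobczyk's argument. The remainder `ψ` kills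
finite sets modulo `c₀`. Finitely many members of an almost disjoint family are disjoint up to a
finite set, so their signed sums have norm at most 1 after a finite correction, and the values of
`ψ` on them are eventually bounded in `ℓ₁`. Martin's axiom then gives measures on `ℕ`, of bounded
variation and with supports tending to infinity, that match `ψ` asymptotically on every infinite
member used (`exists_seq_massOn_tendsto`).

After subtracting these as well, what is left tends to zero on a closed subspace containing the
constants, the points and a generating family. That subspace is all of `C(K)` by Stone-Weierstrass
(`eq_top_of_indic_mem`). -/

theorem MartinAxiom.exists_directedOn {κ : Cardinal.{0}} (hMA : MartinAxiom κ) {P : Type}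
    [PartialOrder P] [Nonempty P] (hP : IsCCC P) {I : Type} [Nonempty I]
    (hI : #I ≤ max κ ℵ₀) (D : I → Set P) (hD : ∀ ξ, IsDenseUp (D ξ)) :
    ∃ G : Set P, DirectedOn (· ≤ ·) G ∧ ∀ ξ, (G ∩ D ξ).Nonempty := by
  rcases le_or_gt #I ℵ₀ with hc | hc
  -- Countably many dense sets are met by the Rasiowa-Sikorski construction, without the axiom; this
  -- is needed when `κ` is finite and the index set is not.
  · have : Countable I := Cardinal.mk_le_aleph0_iff.1 hc
    have := Encodable.ofCountable I
    let 𝒟 : I → Order.Cofinal P := fun ξ => ⟨D ξ, fun p => by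
      obtain ⟨d, hd, h⟩ := hD ξ p
      exact ⟨d, hd, h⟩⟩
    let p : P := Classical.arbitrary P
    refine ⟨Order.idealOfCofinals p 𝒟, (Order.idealOfCofinals p 𝒟).directed, fun ξ => ?_⟩
    obtain ⟨x, hx, hx'⟩ := Order.cofinal_meets_idealOfCofinals p 𝒟 ξ
    exact ⟨x, hx', hx⟩
  · have hle : #I ≤ #κ.out := by
      rw [Cardinal.mk_out]
      exact (le_max_iff.1 hI).resolve_right (not_le.2 hc)
    obtain ⟨f⟩ := hle
    -- The axiom wants exactly `κ` dense sets, so the given ones are listed with repetitions along a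
    -- left inverse of `f`.
    obtain ⟨G, hG, h⟩ := hMA P hP κ.out (Cardinal.mk_out κ)
      (fun j => D (Function.invFun f j)) (fun j => hD _)
    refine ⟨G, hG, fun ξ => ?_⟩
    have := h (f ξ)
    rwa [Function.leftInverse_invFun f.injective ξ] at this

/-! ### Finitely supported measures on `ℕ` and the partial order for Martin's axiom -/

/-- The value at `A` of the rational measure `m` on `ℕ` with finite support. -/
noncomputable def massOn (m : ℕ →₀ ℚ) (A : Set ℕ) : ℝ :=
  m.sum fun x q => A.indicator (fun _ => (q : ℝ)) x

/-- The total variation of the rational measure `m` on `ℕ` with finite support. -/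
noncomputable def variationOf (m : ℕ →₀ ℚ) : ℝ := m.sum fun _ q => |(q : ℝ)|

theorem variationOf_zero : variationOf 0 = 0 := by simp [variationOf]

/-- Each `A ∈ F` is infinite and meets the other members of `F` in finite sets, so it has a point
beyond `k` lying on no other member. A rational mass near `t A` placed there affects the value at
`A` alone. Rationality is what later leaves only countably many stems. -/
theorem exists_measure_massOn_near {ℬ : Set (Set ℕ)} (had : AlmostDisjoint ℬ)
    (hinf : ∀ A ∈ ℬ, A.Infinite) (F : Finset ℬ) (t : ℬ → ℝ) {C ε : ℝ}
    (ht : ∑ A ∈ F, |t A| ≤ C) (hε : 0 < ε) (k : ℕ) :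
    ∃ m : ℕ →₀ ℚ, variationOf m ≤ C + ε ∧ (∀ x < k, m x = 0) ∧
      ∀ A ∈ F, |massOn m A - t A| ≤ ε := by
  classical
  have hpt : ∀ A : ℬ, ∃ x ∈ A.1, k ≤ x ∧ ∀ B ∈ F, B ≠ A → x ∉ B.1 := by
    intro A
    have hfin : (Set.Iio k ∪ ⋃ B ∈ F.erase A, (A.1 ∩ B.1)).Finite := by
      refine (Set.finite_Iio k).union (Set.Finite.biUnion (Finset.finite_toSet _) ?_)
      intro B hB
      have hne : B ≠ A := Finset.ne_of_mem_erase hB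
      exact had A.2 B.2 fun h => hne (Subtype.ext h.symm)
    obtain ⟨x, hxA, hx⟩ := ((hinf A A.2).sdiff hfin).nonempty
    refine ⟨x, hxA, ?_, fun B hB hne hxB => hx (Or.inr ?_)⟩
    · by_contra h
      exact hx (Or.inl (not_le.1 h))
    · exact Set.mem_biUnion (Finset.mem_erase.2 ⟨hne, hB⟩) ⟨hxA, hxB⟩
  choose x hxA hxk hxF using hpt
  -- The tolerance makes the rounding errors of all of `F` add up to at most `ε`.
  have hq : ∀ A : ℬ, ∃ q : ℚ, |(q : ℝ) - t A| < ε / (F.card + 1) := by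
    intro A
    obtain ⟨q, h1, h2⟩ := exists_rat_btwn
      (show t A - ε / (F.card + 1) < t A + ε / (F.card + 1) by
        have : 0 < ε / ((F.card : ℝ) + 1) := by positivity
        linarith)
    exact ⟨q, abs_lt.2 ⟨by linarith, by linarith⟩⟩
  choose q hq using hq
  have hinj : Set.InjOn x F := by
    intro A hA B hB h
    by_contra hne
    exact hxF B A hA hne (h ▸ hxA A)
  let m : ℕ →₀ ℚ := ∑ A ∈ F, Finsupp.single (x A) (q A)
  have hm : ∀ A ∈ F, m (x A) = q A := by
    intro A hA
    simp only [m, Finsupp.finsetSum_apply]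
    rw [Finset.sum_eq_single A]
    · simp
    · intro B hB hne
      exact Finsupp.single_eq_of_ne fun h => hne (hinj hB hA h.symm)
    · exact fun h => absurd hA h
  have hm0 : ∀ y, y ∉ F.image x → m y = 0 := by
    intro y hy
    simp only [m, Finsupp.finsetSum_apply]
    refine Finset.sum_eq_zero fun B hB => Finsupp.single_eq_of_ne fun h => hy ?_
    exact Finset.mem_image.2 ⟨B, hB, h.symm⟩
  have hsupp : m.support ⊆ F.image x := by
    intro y hy
    by_contra h
    exact (Finsupp.mem_support_iff.1 hy) (hm0 y h)
  have hsum : ∀ f : ℕ → ℚ → ℝ, (∀ y, f y 0 = 0) → m.sum f = ∑ A ∈ F, f (x A) (q A) := by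
    intro f hf
    rw [Finsupp.sum_of_support_subset m hsupp f fun y _ => hf y, Finset.sum_image hinj]
    exact Finset.sum_congr rfl fun A hA => by rw [hm A hA]
  have hεc : ε / ((F.card : ℝ) + 1) ≤ ε := div_le_self hε.le (by linarith [F.card.cast_nonneg (α := ℝ)])
  refine ⟨m, ?_, fun y hy => hm0 y ?_, fun A hA => ?_⟩
  · rw [variationOf, hsum _ (by simp)]
    calc ∑ A ∈ F, |(q A : ℝ)| ≤ ∑ A ∈ F, (|t A| + ε / (F.card + 1)) := by
          refine Finset.sum_le_sum fun A _ => ?_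
          have := abs_sub_abs_le_abs_sub (q A : ℝ) (t A)
          linarith [hq A]
      _ = ∑ A ∈ F, |t A| + F.card * (ε / (F.card + 1)) := by
          rw [Finset.sum_add_distrib, Finset.sum_const, nsmul_eq_mul]
      _ ≤ C + ε := by
          refine add_le_add ht ?_
          rw [mul_div_assoc', div_le_iff₀ (by positivity)]
          nlinarith
  · intro h
    obtain ⟨A, -, rfl⟩ := Finset.mem_image.1 h
    exact absurd (hxk A) (not_le.2 hy)
  · rw [massOn, hsum _ (fun y => by by_cases h : y ∈ A.1 <;> simp [h]), Finset.sum_eq_single A]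
    · rw [Set.indicator_of_mem (hxA A)]
      exact (hq A).le.trans hεc
    · intro B hB hne
      exact Set.indicator_of_notMem (hxF B A hA (Ne.symm hne)) _
    · exact fun h => absurd hA h

/-- Finite approximations, with side conditions `F`, to a sequence of measures on `ℕ` that is
asymptotic to `φ` on every member of `ℬ`. -/
@[ext]
structure Approximation (ℬ : Set (Set ℕ)) (φ : ℬ → ℕ → ℝ) (C : ℝ) where
  length : ℕ
  seq : ℕ → ℕ →₀ ℚ
  side : Finset ℬ
  seq_eq_zero : ∀ i, length ≤ i → seq i = 0
  variation_le : ∀ i, variationOf (seq i) ≤ 2 * C + 1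
  seq_apply : ∀ i, ∀ x < i, seq i x = 0
  side_le : ∀ i, length ≤ i → ∑ A ∈ side, |φ A i| ≤ C

namespace Approximation

variable {ℬ : Set (Set ℕ)} {φ : ℬ → ℕ → ℝ} {C : ℝ}

instance : PartialOrder (Approximation ℬ φ C) where
  le p q := p.length ≤ q.length ∧ (∀ i < p.length, q.seq i = p.seq i) ∧ p.side ⊆ q.side ∧
    ∀ i, p.length ≤ i → i < q.length → ∀ A ∈ p.side, |massOn (q.seq i) A - φ A i| ≤ 1 / (i + 1)
  le_refl p := ⟨le_rfl, fun _ _ => rfl, subset_rfl, fun i h h' => absurd h (not_le.2 h')⟩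
  le_trans p q r hpq hqr := by
    refine ⟨hpq.1.trans hqr.1, fun i hi => ?_, hpq.2.2.1.trans hqr.2.2.1, fun i h1 h2 A hA => ?_⟩
    · rw [hqr.2.1 i (hi.trans_le hpq.1), hpq.2.1 i hi]
    · rcases lt_or_ge i q.length with h | h
      · rw [hqr.2.1 i h]
        exact hpq.2.2.2 i h1 h A hA
      · exact hqr.2.2.2 i h h2 A (hpq.2.2.1 hA)
  le_antisymm p q hpq hqp := by
    have hl : p.length = q.length := le_antisymm hpq.1 hqp.1
    refine Approximation.ext hl (funext fun i => ?_) (subset_antisymm hpq.2.2.1 hqp.2.2.1)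
    rcases lt_or_ge i p.length with h | h
    · exact (hpq.2.1 i h).symm
    · rw [p.seq_eq_zero i h, q.seq_eq_zero i (hl ▸ h)]

theorem le_def {p q : Approximation ℬ φ C} : p ≤ q ↔ p.length ≤ q.length ∧
    (∀ i < p.length, q.seq i = p.seq i) ∧ p.side ⊆ q.side ∧
    ∀ i, p.length ≤ i → i < q.length → ∀ A ∈ p.side,
      |massOn (q.seq i) A - φ A i| ≤ 1 / (i + 1) := Iff.rfl

/-- An approximation can be extended beyond any length, with any larger set of side conditions,
provided that these satisfy the bound `2 * C` on the new indices. -/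
theorem exists_extension (had : AlmostDisjoint ℬ) (hinf : ∀ A ∈ ℬ, A.Infinite) (hC : 0 ≤ C)
    (hφ : ∀ F : Finset ℬ, ∀ᶠ i in atTop, ∑ A ∈ F, |φ A i| ≤ C)
    (p : Approximation ℬ φ C) (F₁ F₂ : Finset ℬ) (h₁ : p.side ⊆ F₁) (h₂ : F₁ ⊆ F₂)
    (h : ∀ i, p.length ≤ i → ∑ A ∈ F₁, |φ A i| ≤ 2 * C) (N : ℕ) :
    ∃ q : Approximation ℬ φ C, p ≤ q ∧ q.side = F₂ ∧ N ≤ q.length ∧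
      ∀ i, p.length ≤ i → i < q.length → ∀ A ∈ F₁,
        |massOn (q.seq i) A - φ A i| ≤ 1 / (i + 1) := by
  classical
  -- The new length must reach `N'`, from where `F₂` obeys the bound `C`. On the indices before
  -- that, only `F₁` is served, because the sum over `F₂` may still be too large there.
  obtain ⟨N', hN'⟩ := eventually_atTop.1 (hφ F₂)
  have hex : ∀ i, ∃ m : ℕ →₀ ℚ, variationOf m ≤ 2 * C + 1 ∧ (∀ x < i, m x = 0) ∧
      (p.length ≤ i → ∀ A ∈ F₁, |massOn m A - φ A i| ≤ 1 / (i + 1)) := by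
    intro i
    by_cases hi : p.length ≤ i
    · obtain ⟨m, hm1, hm2, hm3⟩ := exists_measure_massOn_near had hinf F₁ (fun A => φ A i) (h i hi)
        (show (0 : ℝ) < 1 / (i + 1) by positivity) i
      refine ⟨m, hm1.trans ?_, hm2, fun _ => hm3⟩
      have : 1 / ((i : ℝ) + 1) ≤ 1 := div_le_self zero_le_one (by linarith [i.cast_nonneg (α := ℝ)])
      linarith
    · exact ⟨0, by rw [variationOf_zero]; linarith, fun _ _ => rfl, fun h' => absurd h' hi⟩
  choose m hm1 hm2 hm3 using hex
  let n := max p.length (max N N')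
  let q : Approximation ℬ φ C :=
    { length := n
      seq := fun i => if i < p.length then p.seq i else if i < n then m i else 0
      side := F₂
      seq_eq_zero := fun i hi => by
        have hp : ¬ i < p.length := not_lt.2 ((le_max_left _ _).trans hi)
        rw [if_neg hp, if_neg (not_lt.2 hi)]
      variation_le := fun i => by
        split_ifs
        · exact p.variation_le i
        · exact hm1 i
        · rw [variationOf_zero]; linarith
      seq_apply := fun i x hx => by
        split_ifs
        · exact p.seq_apply i x hx
        · exact hm2 i x hx
        · rfl
      side_le := fun i hi => hN' i
        (((le_max_right _ _).trans (le_max_right _ _)).trans hi) }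
  have hq : ∀ i, p.length ≤ i → i < n → q.seq i = m i := fun i h1 h2 => by
    simp only [q, if_neg (not_lt.2 h1), if_pos h2]
  have key : ∀ i, p.length ≤ i → i < q.length → ∀ A ∈ F₁,
      |massOn (q.seq i) A - φ A i| ≤ 1 / (i + 1) := fun i h1 h2 A hA => by
    rw [hq i h1 h2]
    exact hm3 i h1 A hA
  exact ⟨q, le_def.2 ⟨le_max_left _ _, fun i hi => if_pos hi, h₁.trans h₂,
    fun i h1 h2 A hA => key i h1 h2 A (h₁ hA)⟩, rfl,
    (le_max_left _ _).trans (le_max_right _ _), key⟩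

/-- Two conditions with the same stem are compatible: each side set obeys the bound `C` beyond the
stem, so their union obeys `2 * C`, and a rounding error of at most 1 keeps the variation within `2
* C + 1`. This is why the variation bound is about twice the bound on side sets. -/
theorem isCCC (had : AlmostDisjoint ℬ) (hinf : ∀ A ∈ ℬ, A.Infinite) (hC : 0 ≤ C)
    (hφ : ∀ F : Finset ℬ, ∀ᶠ i in atTop, ∑ A ∈ F, |φ A i| ≤ C) :
    IsCCC (Approximation ℬ φ C) := by
  classical
  intro S hS
  let stem : Approximation ℬ φ C → Σ n : ℕ, (Fin n → ℕ →₀ ℚ) :=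
    fun p => ⟨p.length, fun i => p.seq i⟩
  -- Stems are finite sequences of rational measures of finite support, hence countable in number,
  -- so two conditions in `S` share one.
  have hnot : ¬ Set.InjOn stem S := fun h =>
    hS (Set.MapsTo.countable_of_injOn (Set.mapsTo_univ _ _) h Set.countable_univ)
  simp only [Set.InjOn, not_forall] at hnot
  obtain ⟨p, hp, p', hp', heq, hne⟩ := hnot
  have hl : p.length = p'.length := congrArg Sigma.fst heq
  have hs : ∀ i, p.seq i = p'.seq i := by
    intro i
    rcases lt_or_ge i p.length with h | h
    · obtain ⟨n, s, F, a, b, c, d⟩ := p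
      obtain ⟨n', s', F', a', b', c', d'⟩ := p'
      simp only at hl h ⊢
      subst hl
      have h2 := eq_of_heq (Sigma.mk.inj heq).2
      exact congrFun h2 ⟨i, h⟩
    · rw [p.seq_eq_zero i h, p'.seq_eq_zero i (hl ▸ h)]
  obtain ⟨q, hpq, hside, -, hq⟩ := exists_extension had hinf hC hφ p (p.side ∪ p'.side) _
    Finset.subset_union_left subset_rfl (fun i hi => by
      have h1 := p.side_le i hi
      have h2 := p'.side_le i (hl ▸ hi)
      have h3 : ∑ A ∈ p.side ∪ p'.side, |φ A i| ≤
          ∑ A ∈ p.side, |φ A i| + ∑ A ∈ p'.side, |φ A i| := by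
        rw [← Finset.sum_union_inter]
        exact le_add_of_nonneg_right (Finset.sum_nonneg fun _ _ => abs_nonneg _)
      linarith) 0
  refine ⟨p, hp, p', hp', hne, q, hpq, le_def.2 ⟨hl ▸ hpq.1, fun i hi => ?_, ?_, ?_⟩⟩
  · rw [hpq.2.1 i (hl ▸ hi), hs i]
  · rw [hside]; exact Finset.subset_union_right
  · exact fun i h1 h2 A hA => hq i (hl ▸ h1) h2 A (Finset.mem_union_right _ hA)

end Approximation

open Approximation in
/-- Under `MA(κ)`, a family of real sequences that is indexed by an almost disjoint family and is
asymptotically bounded in `ℓ₁` is asymptotically represented by a bounded sequence of measures on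
`ℕ` whose supports tend to infinity. -/
theorem exists_seq_massOn_tendsto {κ : Cardinal.{0}} (hMA : MartinAxiom κ) {ℬ : Set (Set ℕ)}
    (hcard : #ℬ ≤ κ) (had : AlmostDisjoint ℬ) (hinf : ∀ A ∈ ℬ, A.Infinite) {C : ℝ} (hC : 0 ≤ C)
    (φ : ℬ → ℕ → ℝ) (hφ : ∀ F : Finset ℬ, ∀ᶠ i in atTop, ∑ A ∈ F, |φ A i| ≤ C) :
    ∃ m : ℕ → ℕ →₀ ℚ, (∀ i, variationOf (m i) ≤ 2 * C + 1) ∧ (∀ i, ∀ x < i, m i x = 0) ∧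
      ∀ A : ℬ, Tendsto (fun i => massOn (m i) A - φ A i) atTop (𝓝 0) := by
  classical
  let P := Approximation ℬ φ C
  have : Nonempty P := ⟨⟨0, fun _ => 0, ∅, fun _ _ => rfl,
    fun _ => by rw [variationOf_zero]; linarith, fun _ _ _ => rfl, fun _ _ => by simpa using hC⟩⟩
  let D : ℬ ⊕ ℕ → Set P := Sum.elim (fun A => {p | A ∈ p.side}) (fun n => {p | n ≤ p.length})
  have hside : ∀ (p : P) i, p.length ≤ i → ∑ A ∈ p.side, |φ A i| ≤ 2 * C := fun p i hi => by
    linarith [p.side_le i hi]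
  obtain ⟨G, hG, hGD⟩ := hMA.exists_directedOn (isCCC had hinf hC hφ) (I := ℬ ⊕ ℕ) (by
      rw [Cardinal.mk_sum]
      simp only [Cardinal.lift_id, Cardinal.mk_nat]
      refine (Cardinal.add_le_max _ _).trans ?_
      exact max_le (max_le (hcard.trans (le_max_left _ _)) (le_max_right _ _)) (le_max_right _ _)) D (by
    rintro (A | n) p
    · obtain ⟨q, hpq, hq, -⟩ := exists_extension had hinf hC hφ p p.side (insert A p.side)
        subset_rfl (Finset.subset_insert _ _) (hside p) 0
      exact ⟨q, show A ∈ q.side from hq ▸ Finset.mem_insert_self A p.side, hpq⟩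
    · obtain ⟨q, hpq, -, hq, -⟩ := exists_extension had hinf hC hφ p p.side p.side
        subset_rfl subset_rfl (hside p) n
      exact ⟨q, hq, hpq⟩)
  have hlen : ∀ n : ℕ, ∃ p ∈ G, n ≤ p.length := fun n => by
    obtain ⟨p, hp, hp'⟩ := hGD (Sum.inr n)
    exact ⟨p, hp, hp'⟩
  choose g hgG hg using hlen
  -- Entry `i` of the generic sequence is read from `g (i + 1)`, whose length exceeds `i`;
  -- directedness makes it agree with every condition of `G` long enough to decide it.
  have hm : ∀ p ∈ G, ∀ i < p.length, (g (i + 1)).seq i = p.seq i := by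
    intro p hp i hi
    obtain ⟨r, -, hr1, hr2⟩ := hG p hp _ (hgG (i + 1))
    rw [← hr1.2.1 i hi, hr2.2.1 i (hg (i + 1))]
  refine ⟨fun i => (g (i + 1)).seq i, fun i => (g (i + 1)).variation_le i,
    fun i => (g (i + 1)).seq_apply i, fun A => ?_⟩
  obtain ⟨p, hp, hA⟩ := hGD (Sum.inl A)
  refine squeeze_zero_norm' ?_ tendsto_one_div_add_atTop_nhds_zero_nat
  filter_upwards [eventually_ge_atTop p.length] with i hi
  obtain ⟨r, hrG, hr1, hr2⟩ := hG p hp _ (hgG (i + 1))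
  have hir : i < r.length := (hg (i + 1)).trans hr2.1
  rw [Real.norm_eq_abs, hm r hrG i hir]
  exact hr1.2.2.2 i hi hir A hA

/-! ### Asymptotically linear sequences of functions -/

/-- The space of all real sequences that tend to zero. -/
def nullSeq : Submodule ℝ (ℕ → ℝ) where
  carrier := {a | Tendsto a atTop (𝓝 0)}
  add_mem' {a b} ha hb := by
    have h : Tendsto (a + b) atTop (𝓝 (0 + 0)) := Tendsto.add ha hb
    rwa [add_zero] at h
  zero_mem' := tendsto_const_nhds
  smul_mem' c a ha := by
    have h : Tendsto (c • a) atTop (𝓝 (c * 0)) := Tendsto.const_mul c ha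
    rwa [mul_zero] at h

theorem mem_nullSeq {a : ℕ → ℝ} : a ∈ nullSeq ↔ Tendsto a atTop (𝓝 0) := Iff.rfl

section

variable {V : Type*} [NormedAddCommGroup V] [NormedSpace ℝ V]

/-- A map `φ : V → ℓ_∞`, bounded by `M`, that is linear modulo `c₀`. -/
structure IsAsymptoticallyLinear (φ : V → ℕ → ℝ) (M : ℝ) : Prop where
  bound : ∀ f n, |φ f n| ≤ M * ‖f‖
  add : ∀ f g, φ (f + g) - (φ f + φ g) ∈ nullSeq
  smul : ∀ (c : ℝ) f, φ (c • f) - c • φ f ∈ nullSeq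

namespace IsAsymptoticallyLinear

variable {φ : V → ℕ → ℝ} {M : ℝ}

theorem sub_linear (hφ : IsAsymptoticallyLinear φ M) {a : ℕ → V →ₗ[ℝ] ℝ} {C : ℝ}
    (ha : ∀ n f, |a n f| ≤ C * ‖f‖) : IsAsymptoticallyLinear (fun f n => φ f n - a n f) (M + C) where
  bound f n := by
    have h2 := abs_sub (φ f n) (a n f)
    linarith [hφ.bound f n, ha n f]
  add f g := by
    convert hφ.add f g using 1
    ext n
    simp
    ring
  smul c f := by
    convert hφ.smul c f using 1
    ext n
    simp
    ring

theorem zero (hφ : IsAsymptoticallyLinear φ M) : φ 0 ∈ nullSeq := by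
  simpa using hφ.smul 0 0

theorem sum (hφ : IsAsymptoticallyLinear φ M) {ι : Type*} (F : Finset ι) (c : ι → ℝ)
    (g : ι → V) : φ (∑ j ∈ F, c j • g j) - ∑ j ∈ F, c j • φ (g j) ∈ nullSeq := by
  classical
  induction F using Finset.induction_on with
  | empty => simpa using hφ.zero
  | insert j F hj ih =>
    rw [Finset.sum_insert hj, Finset.sum_insert hj]
    convert add_mem (add_mem (hφ.add (c j • g j) (∑ j ∈ F, c j • g j)) (hφ.smul (c j) (g j))) ih
      using 1
    abel

/-- The subspace of all `f` with `φ f ∈ c₀`. -/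
def ker (hφ : IsAsymptoticallyLinear φ M) : Submodule ℝ V where
  carrier := {f | φ f ∈ nullSeq}
  zero_mem' := hφ.zero
  add_mem' {f g} hf hg := by
    simpa using add_mem (hφ.add f g) (add_mem hf hg)
  smul_mem' c f hf := by
    simpa using add_mem (hφ.smul c f) (nullSeq.smul_mem c hf)

theorem mem_ker (hφ : IsAsymptoticallyLinear φ M) {f : V} : f ∈ hφ.ker ↔ φ f ∈ nullSeq := Iff.rfl

theorem sub_mem_of_sub_mem_ker (hφ : IsAsymptoticallyLinear φ M) {f g : V} (h : f - g ∈ hφ.ker) :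
    φ f - φ g ∈ nullSeq := by
  have h1 := hφ.add (f - g) g
  rw [sub_add_cancel] at h1
  convert add_mem h1 h using 1
  abel

/-- If `g` in the kernel is close to `f`, then `φ f` equals `φ (f - g)` modulo `c₀`, and the latter
is uniformly small by the norm bound. -/
theorem isClosed_ker (hφ : IsAsymptoticallyLinear φ M) : IsClosed (hφ.ker : Set V) := by
  refine isClosed_of_closure_subset fun f hf => ?_
  have hM : M ≤ |M| := le_abs_self M
  rw [SetLike.mem_coe, mem_ker, mem_nullSeq, Metric.tendsto_atTop]
  intro ε hε
  obtain ⟨g, hg, hfg⟩ := Metric.mem_closure_iff.1 hf (ε / (2 * (|M| + 1))) (by positivity)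
  have h := hφ.add g (f - g)
  rw [add_sub_cancel] at h
  have h2 : φ f - φ (f - g) ∈ nullSeq := by
    convert add_mem h hg using 1
    abel
  obtain ⟨N, hN⟩ := Metric.tendsto_atTop.1 h2 (ε / 2) (by positivity)
  refine ⟨N, fun n hn => ?_⟩
  have h3 := hN n hn
  have h4 := hφ.bound (f - g) n
  rw [Real.dist_eq, sub_zero] at h3 ⊢
  rw [dist_eq_norm] at hfg
  have h5 : M * ‖f - g‖ ≤ ε / 2 := by
    calc M * ‖f - g‖ ≤ (|M| + 1) * (ε / (2 * (|M| + 1))) :=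
          mul_le_mul (by linarith) hfg.le (norm_nonneg _) (by positivity)
      _ = ε / 2 := by field_simp
  have h6 := abs_sub_abs_le_abs_sub (φ f n) (φ (f - g) n)
  simp only [Pi.sub_apply] at h3
  linarith

/-- If all signed sums of finitely many vectors have norm at most `1` then their images are
eventually bounded in `ℓ₁`. -/
theorem eventually_sum_abs_le (hφ : IsAsymptoticallyLinear φ M) (hM : 0 ≤ M) {ι : Type*}
    [DecidableEq ι] (F : Finset ι) (g : ι → V)
    (hg : ∀ t : Finset ι, ‖∑ j ∈ F, (if j ∈ t then (1 : ℝ) else -1) • g j‖ ≤ 1) :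
    ∀ᶠ n in atTop, ∑ j ∈ F, |φ (g j) n| ≤ M + 1 := by
  -- There are finitely many sign patterns, so linearity holds with error below 1 for all of them at
  -- once from some index on. The pattern may then be chosen depending on `n`, as the signs of the
  -- `φ (g j) n`.
  have h : ∀ t ∈ F.powerset, ∀ᶠ n in atTop,
      |(φ (∑ j ∈ F, (if j ∈ t then (1 : ℝ) else -1) • g j) -
        ∑ j ∈ F, (if j ∈ t then (1 : ℝ) else -1) • φ (g j)) n| < 1 := fun t _ => by
    have := (hφ.sum F (fun j => if j ∈ t then (1 : ℝ) else -1) g : Tendsto _ _ _)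
    simpa using (Metric.tendsto_nhds.1 this) 1 one_pos
  filter_upwards [(Filter.eventually_all_finset _).2 h] with n hn
  have h1 := hn (F.filter fun j => 0 ≤ φ (g j) n) (by simp)
  have h2 := hφ.bound (∑ j ∈ F,
    (if j ∈ F.filter (fun j => 0 ≤ φ (g j) n) then (1 : ℝ) else -1) • g j) n
  have h3 := hg (F.filter fun j => 0 ≤ φ (g j) n)
  have h4 : (∑ j ∈ F, (if j ∈ F.filter (fun j => 0 ≤ φ (g j) n) then (1 : ℝ) else -1) •
      φ (g j)) n = ∑ j ∈ F, |φ (g j) n| := by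
    rw [Finset.sum_apply]
    refine Finset.sum_congr rfl fun j hj => ?_
    by_cases h : 0 ≤ φ (g j) n
    · simp [hj, h, abs_of_nonneg h]
    · simp [h, abs_of_neg (not_le.1 h)]
  rw [Pi.sub_apply, h4] at h1
  have h5 := (abs_lt.1 h1).1
  have h6 := (abs_le.1 h2).2
  nlinarith [mul_le_mul_of_nonneg_left h3 hM]

end IsAsymptoticallyLinear

/-- Every bounded linear operator `V → ℓ_∞ / c₀`, represented by a bounded map `V → ℓ_∞` that is
linear modulo `c₀`, lifts to a bounded linear operator `V → ℓ_∞`, represented by a bounded sequence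
of functionals. -/
def HasLifts (V : Type*) [NormedAddCommGroup V] [NormedSpace ℝ V] : Prop :=
  ∀ (φ : V → ℕ → ℝ) (M : ℝ), 0 ≤ M → IsAsymptoticallyLinear φ M →
    ∃ (μ : ℕ → V →ₗ[ℝ] ℝ) (C : ℝ), (∀ n f, |μ n f| ≤ C * ‖f‖) ∧
      ∀ f, Tendsto (fun n => φ f n - μ n f) atTop (𝓝 0)

end

/-! ### Functionals of finite support -/

section

variable {K : Type*} [TopologicalSpace K]

/-- The evaluation functional at `x`. -/
def evalAt (x : K) : C(K, ℝ) →ₗ[ℝ] ℝ where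
  toFun f := f x
  map_add' _ _ := rfl
  map_smul' _ _ := rfl

@[simp]
theorem evalAt_apply (x : K) (f : C(K, ℝ)) : evalAt x f = f x := rfl

/-- The functional `f ↦ ∑ j ∈ F, c j * (f (x j) - f u)`. -/
def pointCombination (x : ℕ → K) (u : K) (F : Finset ℕ) (c : ℕ → ℝ) : C(K, ℝ) →ₗ[ℝ] ℝ :=
  ∑ j ∈ F, c j • (evalAt (x j) - evalAt u)

theorem pointCombination_apply (x : ℕ → K) (u : K) (F : Finset ℕ) (c : ℕ → ℝ) (f : C(K, ℝ)) :
    pointCombination x u F c f = ∑ j ∈ F, c j * (f (x j) - f u) := by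
  simp [pointCombination]

theorem abs_pointCombination_le [CompactSpace K] (x : ℕ → K) (u : K) (F : Finset ℕ) (c : ℕ → ℝ)
    (f : C(K, ℝ)) : |pointCombination x u F c f| ≤ 2 * (∑ j ∈ F, |c j|) * ‖f‖ := by
  rw [pointCombination_apply, Finset.mul_sum, Finset.sum_mul]
  refine (Finset.abs_sum_le_sum_abs _ _).trans (Finset.sum_le_sum fun j _ => ?_)
  rw [abs_mul, mul_comm 2, mul_assoc]
  refine mul_le_mul_of_nonneg_left ?_ (abs_nonneg _)
  have h1 := f.norm_coe_le_norm (x j)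
  have h2 := f.norm_coe_le_norm u
  rw [Real.norm_eq_abs] at h1 h2
  linarith [abs_sub (f (x j)) (f u)]

/-- Sobczyk's argument: an asymptotically linear map on `C(K)` agrees modulo `c₀` with a sequence of
functionals on the constants and on the characteristic functions of countably many isolated
points. -/
theorem IsAsymptoticallyLinear.exists_linear_on_isolated [CompactSpace K]
    {φ : C(K, ℝ) → ℕ → ℝ} {M : ℝ}
    (hφ : IsAsymptoticallyLinear φ M) (hM : 0 ≤ M) (x : ℕ → K) (u : K) (e : ℕ → C(K, ℝ))
    (hex : ∀ j k, e k (x j) = if j = k then 1 else 0) (heu : ∀ k, e k u = 0)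
    (he : ∀ F t : Finset ℕ, ‖∑ j ∈ F, (if j ∈ t then (1 : ℝ) else -1) • e j‖ ≤ 1) :
    ∃ (a : ℕ → C(K, ℝ) →ₗ[ℝ] ℝ) (C : ℝ), 0 ≤ C ∧ (∀ n f, |a n f| ≤ C * ‖f‖) ∧
      (fun n => φ 1 n - a n 1) ∈ nullSeq ∧ ∀ k, (fun n => φ (e k) n - a n (e k)) ∈ nullSeq := by
  classical
  let p : ℕ → ℕ → Prop := fun n k => ∑ j ∈ Finset.range k, |φ (e j) n| ≤ M + 1
  -- The longest initial block, of length at most `n`, whose `ℓ₁` sum is under control at `n`.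
  -- Truncating there keeps the functionals bounded, and `k n → ∞` means each point is eventually
  -- included.
  let k : ℕ → ℕ := fun n => Nat.findGreatest (p n) n
  have hp0 : ∀ n, p n 0 := fun n => by simp only [p, Finset.range_zero, Finset.sum_empty]; linarith
  have hk : ∀ n, p n (k n) := fun n => Nat.findGreatest_spec (Nat.zero_le n) (hp0 n)
  have hk' : Tendsto k atTop atTop := by
    refine tendsto_atTop.2 fun b => ?_
    filter_upwards [hφ.eventually_sum_abs_le hM (Finset.range b) e (he _), eventually_ge_atTop b]
      with n h1 h2
    exact Nat.le_findGreatest h2 h1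
  have h1 : ‖(1 : C(K, ℝ))‖ ≤ 1 := (ContinuousMap.norm_le _ zero_le_one).2 fun x => by simp
  -- Differences of evaluations vanish on constants and each `e l` vanishes at `u`, so the two
  -- summands treat the constants and the points independently.
  refine ⟨fun n => φ 1 n • evalAt u +
    pointCombination x u (Finset.range (k n)) fun j => φ (e j) n, M + 2 * (M + 1), by positivity,
    fun n f => ?_, ?_, fun l => ?_⟩
  · have h2 : |φ 1 n| ≤ M := (hφ.bound 1 n).trans (mul_le_of_le_one_right hM h1)
    have h3 := abs_pointCombination_le x u (Finset.range (k n)) (fun j => φ (e j) n) f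
    have h4 : |f u| ≤ ‖f‖ := f.norm_coe_le_norm u
    have h5 : |φ 1 n * f u| ≤ M * ‖f‖ := by
      rw [abs_mul]
      exact mul_le_mul h2 h4 (abs_nonneg _) hM
    have h6 := mul_le_mul_of_nonneg_right (hk n) (norm_nonneg f)
    have h7 := abs_add_le (φ 1 n * f u)
      (pointCombination x u (Finset.range (k n)) (fun j => φ (e j) n) f)
    simp only [LinearMap.add_apply, LinearMap.smul_apply, evalAt_apply, smul_eq_mul]
    linarith
  · convert nullSeq.zero_mem using 1
    ext n
    simp [pointCombination_apply]
  · refine tendsto_const_nhds.congr' ?_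
    filter_upwards [hk'.eventually_gt_atTop l] with n hn
    simp [pointCombination_apply, hex, heu, hn]

end

/-! ### A generating set avoiding an ultrafilter -/

/-- The ultrafilter supplies the base point `u` subtracted in `pointCombination`, and the
characteristic functions of the generators should vanish there. If no finite subfamily covers a
cofinite set, a free ultrafilter avoids all of `𝒜`. Otherwise any free ultrafilter contains at most
one member, which is redundant as a generator. -/
theorem exists_ultrafilter_generatedAlgebra {𝒜 : Set (Set ℕ)} (h𝒜 : AlmostDisjoint 𝒜) :
    ∃ U : Ultrafilter ℕ, (∀ F : Set ℕ, F.Finite → F ∉ U) ∧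
      generatedAlgebra 𝒜 ≤ generatedAlgebra {A ∈ 𝒜 | A ∉ U} := by
  classical
  have hfree : ∀ U : Ultrafilter ℕ, (U : Filter ℕ) ≤ cofinite → ∀ F : Set ℕ, F.Finite → F ∉ U :=
    fun U hU F hF hFU =>
      U.empty_notMem (by simpa using Filter.inter_mem hFU (hU hF.compl_mem_cofinite))
  by_cases hne : (cofinite ⊓ ⨅ A : 𝒜, 𝓟 ((A : Set ℕ)ᶜ)).NeBot
  · let U := Ultrafilter.of (cofinite ⊓ ⨅ A : 𝒜, 𝓟 ((A : Set ℕ)ᶜ))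
    have hU : (U : Filter ℕ) ≤ _ := Ultrafilter.of_le _
    refine ⟨U, hfree U (hU.trans inf_le_left), BooleanSubalgebra.closure_mono
      (Set.union_subset_union_left _ fun A hA => ⟨hA, ?_⟩)⟩
    refine Ultrafilter.compl_mem_iff_notMem.1 ?_
    exact hU.trans (inf_le_right.trans (iInf_le _ ⟨A, hA⟩)) (mem_principal_self _)
  · let U := hyperfilter ℕ
    have hU := hfree U hyperfilter_le_cofinite
    refine ⟨U, hU, ?_⟩
    rw [not_neBot, ← disjoint_iff, Filter.disjoint_iff] at hne
    obtain ⟨s, hs, t, ht, hst⟩ := hne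
    obtain ⟨F, hF⟩ : ∃ F : Finset 𝒜, (⋂ A ∈ F, (A : Set ℕ)ᶜ) ⊆ t := by
      obtain ⟨F, hF⟩ := (mem_iInf_finite t).1 ht
      rw [iInf_principal_finset, mem_principal] at hF
      exact ⟨F, hF⟩
    have hcof : ((⋃ A ∈ F, A.1)ᶜ).Finite := by
      refine (mem_cofinite.1 hs).subset fun x hx hxs => Set.disjoint_left.1 hst hxs (hF ?_)
      simpa using hx
    refine BooleanSubalgebra.closure_le.2 (Set.union_subset (fun A hA => ?_) fun E hE =>
      BooleanSubalgebra.subset_closure (Or.inr hE))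
    by_cases hAU : A ∈ U
    swap
    · exact BooleanSubalgebra.subset_closure (Or.inl ⟨hA, hAU⟩)
    have huniq : ∀ B ∈ 𝒜, B ≠ A → B ∉ U := fun B hB hne hBU =>
      hU _ (h𝒜 hB hA hne) (Filter.inter_mem hBU hAU)
    let L := generatedAlgebra {A ∈ 𝒜 | A ∉ U}
    let R : Set ℕ := ⋃ B ∈ F.filter (fun B : 𝒜 => B.1 ≠ A), B.1
    have hR : R ∈ L := by
      refine L.biSup_mem (Finset.finite_toSet _) fun B hB => ?_
      have hB' := (Finset.mem_filter.1 hB).2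
      exact BooleanSubalgebra.subset_closure (Or.inl ⟨B.2, huniq B B.2 hB'⟩)
    have hfin : ∀ E : Set ℕ, E.Finite → E ∈ L := fun E hE =>
      BooleanSubalgebra.subset_closure (Or.inr hE)
    have hAR : (A ∩ R).Finite := by
      rw [Set.inter_iUnion₂]
      refine Set.Finite.biUnion (Finset.finite_toSet _) fun B hB => ?_
      exact h𝒜 hA B.2 (Finset.mem_filter.1 hB).2.symm
    have hARc : (Rᶜ \ A).Finite := by
      refine hcof.subset fun x hx => ?_
      simp only [R, Set.mem_sdiff, Set.mem_compl_iff, Set.mem_iUnion, not_exists,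
        Finset.mem_filter, and_imp] at hx ⊢
      intro B hB hxB
      by_cases h : B.1 = A
      · exact hx.2 (h ▸ hxB)
      · exact hx.1 B hB h hxB
    -- Up to finite sets, `A` is the complement of the union of the other members of the finite
    -- cover.
    have hA' : A = (Rᶜ \ (Rᶜ \ A)) ∪ (A ∩ R) := by
      ext x
      by_cases h1 : x ∈ R <;> by_cases h2 : x ∈ A <;> simp [h1, h2]
    rw [hA']
    exact L.supClosed (L.sdiff_mem (L.compl_mem hR) (hfin _ hARc)) (hfin _ hAR)

/-! ### Characteristic functions on the Stone space -/

namespace StoneSpace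

variable {𝔄 : BooleanSubalgebra (Set ℕ)}

theorem isClopen_basic {B : Type*} [BooleanAlgebra B] (a : B) : IsClopen (basic a) := by
  refine ⟨⟨?_⟩, isOpen_basic a⟩
  convert isOpen_basic aᶜ using 1
  ext x
  exact (compl_mem_iff x a).symm

/-- The trace on `𝔄` of an ultrafilter on `ℕ`. -/
def ofUltrafilter (𝔄 : BooleanSubalgebra (Set ℕ)) (U : Ultrafilter ℕ) : StoneSpace 𝔄 where
  carrier := {a | (a : Set ℕ) ∈ U}
  top_mem := Filter.univ_mem
  bot_notMem := U.empty_notMem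
  mem_of_le ha hab := Filter.mem_of_superset ha hab
  inf_mem ha hb := Filter.inter_mem ha hb
  mem_or_compl_mem a := U.mem_or_compl_mem a

open Classical in
/-- The characteristic function of the clopen set of all ultrafilters on `𝔄` that contain `s`,
for `s ∈ 𝔄`, and `0` otherwise. -/
noncomputable def indic (𝔄 : BooleanSubalgebra (Set ℕ)) (s : Set ℕ) : C(StoneSpace 𝔄, ℝ) :=
  if h : s ∈ 𝔄 then
    ⟨(basic (⟨s, h⟩ : 𝔄)).indicator 1,
      continuous_one.indicator fun y hy => by simp [(isClopen_basic _).frontier_eq] at hy⟩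
  else 0

open Classical in
theorem indic_apply {s : Set ℕ} (hs : s ∈ 𝔄) (y : StoneSpace 𝔄) :
    indic 𝔄 s y = if (⟨s, hs⟩ : 𝔄) ∈ y.carrier then 1 else 0 := by
  rw [indic, dif_pos hs]
  rfl

open Classical in
theorem indic_ofUltrafilter {s : Set ℕ} (hs : s ∈ 𝔄) (U : Ultrafilter ℕ) :
    indic 𝔄 s (ofUltrafilter 𝔄 U) = if s ∈ U then 1 else 0 :=
  indic_apply hs _

theorem indic_inter {s t : Set ℕ} (hs : s ∈ 𝔄) (ht : t ∈ 𝔄) :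
    indic 𝔄 (s ∩ t) = indic 𝔄 s * indic 𝔄 t := by
  classical
  ext y
  rw [ContinuousMap.mul_apply, indic_apply hs, indic_apply ht, indic_apply (s := s ∩ t) (𝔄.inf_mem hs ht)]
  have h : (⟨s ∩ t, 𝔄.inf_mem hs ht⟩ : 𝔄) ∈ y.carrier ↔
      (⟨s, hs⟩ : 𝔄) ∈ y.carrier ∧ (⟨t, ht⟩ : 𝔄) ∈ y.carrier :=
    ⟨fun h => ⟨y.mem_of_le h Set.inter_subset_left, y.mem_of_le h Set.inter_subset_right⟩,
      fun h => y.inf_mem h.1 h.2⟩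
  by_cases h1 : (⟨s, hs⟩ : 𝔄) ∈ y.carrier <;> by_cases h2 : (⟨t, ht⟩ : 𝔄) ∈ y.carrier <;>
    simp [h, h1, h2]

theorem indic_compl {s : Set ℕ} (hs : s ∈ 𝔄) : indic 𝔄 sᶜ = 1 - indic 𝔄 s := by
  classical
  ext y
  rw [ContinuousMap.sub_apply, indic_apply hs, indic_apply (𝔄.compl_mem hs)]
  have h : (⟨sᶜ, 𝔄.compl_mem hs⟩ : 𝔄) ∈ y.carrier ↔ (⟨s, hs⟩ : 𝔄) ∉ y.carrier :=
    compl_mem_iff y ⟨s, hs⟩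
  by_cases h1 : (⟨s, hs⟩ : 𝔄) ∈ y.carrier <;> simp [h, h1]

theorem indic_empty : indic 𝔄 ∅ = 0 := by
  classical
  ext y
  rw [indic_apply (s := ∅) 𝔄.bot_mem]
  exact if_neg y.bot_notMem

theorem indic_sdiff_add_inter {s t : Set ℕ} (hs : s ∈ 𝔄) (ht : t ∈ 𝔄) :
    indic 𝔄 (s \ t) + indic 𝔄 (s ∩ t) = indic 𝔄 s := by
  rw [Set.sdiff_eq, indic_inter hs (𝔄.compl_mem ht), indic_inter hs ht, indic_compl ht]
  ring

/-- An ultrafilter contains at most one of the disjoint sets, so at each point at most one term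
survives. -/
theorem norm_sum_indic_le {ι : Type*} (F : Finset ι) (s : ι → Set ℕ)
    (hs : ∀ j ∈ F, s j ∈ 𝔄) (hd : (F : Set ι).PairwiseDisjoint s) (c : ι → ℝ)
    (hc : ∀ j, |c j| ≤ 1) : ‖∑ j ∈ F, c j • indic 𝔄 (s j)‖ ≤ 1 := by
  classical
  refine (ContinuousMap.norm_le _ zero_le_one).2 fun y => ?_
  have happ : (∑ j ∈ F, c j • indic 𝔄 (s j)) y = ∑ j ∈ F, c j * indic 𝔄 (s j) y := by simp
  rw [happ, Real.norm_eq_abs]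
  by_cases h : ∃ j, ∃ hj : j ∈ F, (⟨s j, hs j hj⟩ : 𝔄) ∈ y.carrier
  · obtain ⟨j, hj, hjy⟩ := h
    rw [Finset.sum_eq_single j]
    · rw [indic_apply (hs j hj), if_pos hjy, mul_one]
      exact hc j
    · intro k hk hkj
      rw [indic_apply (hs k hk), if_neg, mul_zero]
      intro hky
      refine y.bot_notMem ?_
      convert y.inf_mem hky hjy using 1
      exact Subtype.ext (Set.disjoint_iff_inter_eq_empty.1 (hd hk hj hkj)).symm
    · exact fun h => absurd hj h
  · rw [Finset.sum_eq_zero, abs_zero]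
    · exact zero_le_one
    · intro j hj
      rw [indic_apply (hs j hj), if_neg fun hjy => h ⟨j, hj, hjy⟩, mul_zero]

theorem indic_mem_of_finite {W : Submodule ℝ C(StoneSpace 𝔄, ℝ)}
    (hfin : ∀ E : Set ℕ, E.Finite → E ∈ 𝔄) (hW : ∀ k, indic 𝔄 {k} ∈ W) {E : Set ℕ}
    (hE : E.Finite) : indic 𝔄 E ∈ W := by
  induction E, hE using Set.Finite.induction_on with
  | empty => rw [indic_empty]; exact W.zero_mem
  | @insert k E hk hE ih =>
    rw [← indic_sdiff_add_inter (hfin _ (hE.insert k)) (hfin _ hE)]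
    have h1 : insert k E \ E = {k} := by
      ext x
      by_cases hx : x = k
      · simp [hx, hk]
      · simp [hx]
    have h2 : insert k E ∩ E = E := Set.inter_eq_right.2 (Set.subset_insert _ _)
    rw [h1, h2]
    exact W.add_mem (hW k) ih

end StoneSpace

open StoneSpace

theorem finite_mem_generatedAlgebra {𝒜 : Set (Set ℕ)} {E : Set ℕ} (hE : E.Finite) :
    E ∈ generatedAlgebra 𝒜 :=
  BooleanSubalgebra.subset_closure (Or.inr hE)

theorem mem_generatedAlgebra {𝒜 : Set (Set ℕ)} {A : Set ℕ} (hA : A ∈ 𝒜) :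
    A ∈ generatedAlgebra 𝒜 :=
  BooleanSubalgebra.subset_closure (Or.inl hA)

/-- A closed subspace of `C(K)` contains everything if it contains the constants and the
characteristic functions of the members of a generating almost disjoint family and of the points
of `ℕ`. -/
theorem eq_top_of_indic_mem {𝒜 ℬ : Set (Set ℕ)} (had : AlmostDisjoint ℬ) (hsub : ℬ ⊆ 𝒜)
    (hgen : generatedAlgebra 𝒜 ≤ generatedAlgebra ℬ)
    (W : Submodule ℝ C(StoneSpace (generatedAlgebra 𝒜), ℝ)) (hW : IsClosed (W : Set C(StoneSpace (generatedAlgebra 𝒜), ℝ)))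
    (hone : 1 ∈ W) (hpt : ∀ k : ℕ, indic _ {k} ∈ W) (hmem : ∀ A ∈ ℬ, indic _ A ∈ W) : W = ⊤ := by
  let 𝔄 := generatedAlgebra 𝒜
  have hfin : ∀ E : Set ℕ, E.Finite → E ∈ 𝔄 := fun E hE => finite_mem_generatedAlgebra hE
  have hℬ : ∀ A ∈ ℬ, A ∈ 𝔄 := fun A hA => mem_generatedAlgebra (hsub hA)
  -- Almost disjointness makes these functions closed under products, so the algebra they generate
  -- is merely their linear span and lies in `W`.
  let S : Submonoid C(StoneSpace 𝔄, ℝ) :=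
    { carrier := {f | f = 1 ∨ ∃ s ∈ ℬ ∪ {E | E.Finite}, f = indic 𝔄 s}
      one_mem' := Or.inl rfl
      mul_mem' := by
        rintro f g (rfl | ⟨s, hs, rfl⟩) hg
        · rwa [one_mul]
        · rcases hg with rfl | ⟨t, ht, rfl⟩
          · rw [mul_one]
            exact Or.inr ⟨s, hs, rfl⟩
          · have hs' : s ∈ 𝔄 := hs.elim (hℬ s) (hfin s)
            have ht' : t ∈ 𝔄 := ht.elim (hℬ t) (hfin t)
            refine Or.inr ⟨s ∩ t, ?_, (indic_inter hs' ht').symm⟩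
            rcases hs with hs | hs
            · rcases ht with ht | ht
              · by_cases hst : s = t
                · rw [← hst, Set.inter_self]
                  exact Or.inl hs
                · exact Or.inr (had hs ht hst)
              · exact Or.inr (Set.Finite.inter_of_right ht s)
            · exact Or.inr (Set.Finite.inter_of_left hs t) }
  let R : Subalgebra ℝ C(StoneSpace 𝔄, ℝ) := Algebra.adjoin ℝ (S : Set C(StoneSpace 𝔄, ℝ))
  have hRW : ∀ f ∈ R, f ∈ W := by
    intro f hf
    have h1 : f ∈ Subalgebra.toSubmodule R := hf
    rw [Algebra.adjoin_eq_span, Submonoid.closure_eq] at h1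
    refine Submodule.span_le.2 ?_ h1
    rintro g (rfl | ⟨s, hs | hs, rfl⟩)
    · exact hone
    · exact hmem s hs
    · exact indic_mem_of_finite hfin hpt hs
  have hgenR : ∀ s ∈ ℬ ∪ {E | E.Finite}, indic 𝔄 s ∈ R := fun s hs =>
    Algebra.subset_adjoin (Or.inr ⟨s, hs, rfl⟩)
  -- The sets with characteristic function in `R` form a Boolean algebra containing the generators,
  -- hence all of `𝔄`; this lets `R` separate points.
  let L : BooleanSubalgebra (Set ℕ) :=
    { carrier := {s | s ∈ 𝔄 ∧ indic 𝔄 s ∈ R}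
      supClosed' := by
        rintro s ⟨hs, hs'⟩ t ⟨ht, ht'⟩
        refine ⟨𝔄.sup_mem hs ht, ?_⟩
        have h1 : s ⊔ t = (sᶜ ∩ tᶜ)ᶜ := by
          rw [Set.compl_inter, compl_compl, compl_compl]
          rfl
        rw [h1, indic_compl (s := sᶜ ∩ tᶜ) (𝔄.inf_mem (𝔄.compl_mem hs) (𝔄.compl_mem ht)),
          indic_inter (𝔄.compl_mem hs) (𝔄.compl_mem ht), indic_compl hs, indic_compl ht]
        exact R.sub_mem R.one_mem (R.mul_mem (R.sub_mem R.one_mem hs') (R.sub_mem R.one_mem ht'))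
      infClosed' := by
        rintro s ⟨hs, hs'⟩ t ⟨ht, ht'⟩
        refine ⟨𝔄.inf_mem hs ht, ?_⟩
        have h1 : s ⊓ t = s ∩ t := rfl
        rw [h1, indic_inter hs ht]
        exact R.mul_mem hs' ht'
      compl_mem' := by
        rintro s ⟨hs, hs'⟩
        refine ⟨𝔄.compl_mem hs, ?_⟩
        rw [indic_compl hs]
        exact R.sub_mem R.one_mem hs'
      bot_mem' := ⟨𝔄.bot_mem, hgenR _ (Or.inr Set.finite_empty)⟩ }
  have hL : 𝔄 ≤ L := hgen.trans (BooleanSubalgebra.closure_le.2 fun s hs =>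
    ⟨hs.elim (hℬ s) (hfin s), hgenR s hs⟩)
  have hsep : R.SeparatesPoints := by
    classical
    intro x y hxy
    have : ∃ a : 𝔄, ¬ (a ∈ x.carrier ↔ a ∈ y.carrier) := by
      by_contra! h
      exact hxy (StoneSpace.ext (Set.ext h))
    obtain ⟨⟨s, hs⟩, hsxy⟩ := this
    refine ⟨indic 𝔄 s, ⟨indic 𝔄 s, (hL hs).2, rfl⟩, ?_⟩
    rw [indic_apply hs, indic_apply hs]
    intro h
    by_cases h1 : (⟨s, hs⟩ : 𝔄) ∈ x.carrier <;> by_cases h2 : (⟨s, hs⟩ : 𝔄) ∈ y.carrier <;>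
      simp [h1, h2] at h hsxy
  have hdense := ContinuousMap.subalgebra_topologicalClosure_eq_top_of_separatesPoints R hsep
  rw [eq_top_iff]
  intro f _
  have hf : f ∈ R.topologicalClosure := by rw [hdense]; trivial
  exact closure_minimal (fun g hg => hRW g hg) hW hf

/-! ### The lifting theorem -/

/-- Under `MA(κ)`, every bounded operator from `C(K)` to `ℓ_∞ / c₀` lifts to `ℓ_∞`, where `K` is
the Stone space of the algebra generated by an almost disjoint family of size at most `κ`. -/
theorem hasLifts_stoneSpace {κ : Cardinal.{0}} (hMA : MartinAxiom κ) {𝒜 : Set (Set ℕ)}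
    (h𝒜 : AlmostDisjoint 𝒜) (hcard : #𝒜 ≤ κ) :
    HasLifts C(StoneSpace (generatedAlgebra 𝒜), ℝ) := by
  classical
  intro φ M hM hφ
  obtain ⟨U, hUfin, hUgen⟩ := exists_ultrafilter_generatedAlgebra h𝒜
  let 𝔄 := generatedAlgebra 𝒜
  have hfin : ∀ E : Set ℕ, E.Finite → E ∈ 𝔄 := fun E hE => finite_mem_generatedAlgebra hE
  have hmem : ∀ A ∈ 𝒜, A ∈ 𝔄 := fun A hA => mem_generatedAlgebra hA
  let u : StoneSpace 𝔄 := ofUltrafilter 𝔄 U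
  let x : ℕ → StoneSpace 𝔄 := fun n => ofUltrafilter 𝔄 (pure n)
  have hx : ∀ s ∈ 𝔄, ∀ n, indic 𝔄 s (x n) = if n ∈ s then 1 else 0 := fun s hs n => by
    rw [indic_ofUltrafilter hs]
    simp
  have hu : ∀ s ∈ 𝔄, s ∉ U → indic 𝔄 s u = 0 := fun s hs hsU => by
    rw [indic_ofUltrafilter hs, if_neg hsU]
  have hsing : ∀ k : ℕ, ({k} : Set ℕ) ∈ 𝔄 := fun k => hfin _ (Set.finite_singleton k)
  have habs : ∀ (p : Prop) [Decidable p], |if p then (1 : ℝ) else -1| ≤ 1 := fun p _ => by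
    split_ifs <;> simp
  obtain ⟨a, C, hC, ha, ha1, hae⟩ := hφ.exists_linear_on_isolated hM x u (fun k => indic 𝔄 {k})
    (fun j k => by rw [hx _ (hsing k)]; simp) (fun k => hu _ (hsing k) (hUfin _ (finite_singleton k)))
    (fun F t => norm_sum_indic_le F (fun k => {k}) (fun k _ => hsing k)
      (fun i _ j _ hij => Set.disjoint_singleton.2 hij) _ fun j => habs _)
  let ψ : C(StoneSpace 𝔄, ℝ) → ℕ → ℝ := fun f n => φ f n - a n f
  have hψ : IsAsymptoticallyLinear ψ (M + C) := hφ.sub_linear ha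
  have hψfin : ∀ E : Set ℕ, E.Finite → indic 𝔄 E ∈ hψ.ker := fun E hE =>
    indic_mem_of_finite hfin hae hE
  let ℬ : Set (Set ℕ) := {A ∈ 𝒜 | A ∉ U ∧ A.Infinite}
  have hℬ : AlmostDisjoint ℬ := h𝒜.mono fun A hA => hA.1
  have hbd : ∀ F : Finset ℬ, ∀ᶠ n in atTop, ∑ A ∈ F, |ψ (indic 𝔄 A) n| ≤ M + C + 2 := by
    intro F
    -- Removing this finite overlap makes the members of `F` disjoint. It changes `ψ` only by null
    -- sequences, which costs 1 in the eventual `ℓ₁` bound on top of `M + C + 1`.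
    have hE : (⋃ A ∈ F, ⋃ B ∈ F.erase A, (A.1 ∩ B.1)).Finite :=
      Set.Finite.biUnion (Finset.finite_toSet _) fun A _ =>
        Set.Finite.biUnion (Finset.finite_toSet _) fun B hB =>
          hℬ A.2 B.2 fun h => Finset.ne_of_mem_erase hB (Subtype.ext h.symm)
    set E := ⋃ A ∈ F, ⋃ B ∈ F.erase A, (A.1 ∩ B.1) with hEdef
    have hmem' : ∀ A : ℬ, A.1 \ E ∈ 𝔄 := fun A => 𝔄.sdiff_mem (hmem A A.2.1) (hfin E hE)
    have h1 := hψ.eventually_sum_abs_le (by positivity) F (fun A => indic 𝔄 (A.1 \ E)) fun t =>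
      norm_sum_indic_le F (fun A : ℬ => A.1 \ E) (fun A _ => hmem' A) (fun A hA B hB hAB =>
        Set.disjoint_left.2 fun y hyA hyB => hyA.2 (Set.mem_biUnion hA (Set.mem_biUnion
          (Finset.mem_erase.2 ⟨hAB.symm, hB⟩) ⟨hyA.1, hyB.1⟩))) _ fun j => habs _
    have h2 : ∀ A ∈ F, Tendsto (fun n => |(ψ (indic 𝔄 A.1) - ψ (indic 𝔄 (A.1 \ E))) n|) atTop
        (𝓝 0) := fun A _ => by
      have h3 : indic 𝔄 A.1 - indic 𝔄 (A.1 \ E) ∈ hψ.ker := by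
        rw [← indic_sdiff_add_inter (hmem A A.2.1) (hfin E hE), add_sub_cancel_left]
        exact hψfin _ (hE.inter_of_right _)
      simpa using (mem_nullSeq.1 (hψ.sub_mem_of_sub_mem_ker h3)).abs
    have h4 := tendsto_finsetSum F h2
    rw [Finset.sum_const_zero] at h4
    filter_upwards [h1, h4.eventually_le_const one_pos] with n h5 h6
    have h7 : ∑ A ∈ F, |ψ (indic 𝔄 A) n| ≤ ∑ A ∈ F, |ψ (indic 𝔄 (A.1 \ E)) n| +
        ∑ A ∈ F, |(ψ (indic 𝔄 A.1) - ψ (indic 𝔄 (A.1 \ E))) n| := by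
      rw [← Finset.sum_add_distrib]
      refine Finset.sum_le_sum fun A _ => ?_
      have h8 := abs_sub_abs_le_abs_sub (ψ (indic 𝔄 A.1) n) (ψ (indic 𝔄 (A.1 \ E)) n)
      rw [Pi.sub_apply]
      linarith
    linarith
  obtain ⟨m, hm1, hm2, hm3⟩ := exists_seq_massOn_tendsto hMA
    ((Cardinal.mk_le_mk_of_subset fun A hA => hA.1).trans hcard : #ℬ ≤ κ) hℬ
    (fun A hA => hA.2.2) (by positivity) (fun A n => ψ (indic 𝔄 A) n) hbd
  let b : ℕ → C(StoneSpace 𝔄, ℝ) →ₗ[ℝ] ℝ := fun n =>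
    pointCombination x u (m n).support fun j => (m n j : ℝ)
  have hb : ∀ n f, |b n f| ≤ 2 * (2 * (M + C + 2) + 1) * ‖f‖ := fun n f =>
    (abs_pointCombination_le _ _ _ _ f).trans (mul_le_mul_of_nonneg_right
      (mul_le_mul_of_nonneg_left (hm1 n) zero_le_two) (norm_nonneg f))
  have hbs : ∀ s ∈ 𝔄, s ∉ U → ∀ n, b n (indic 𝔄 s) = massOn (m n) s := by
    intro s hs hsU n
    simp only [b, pointCombination_apply, massOn, Finsupp.sum]
    refine Finset.sum_congr rfl fun j _ => ?_
    rw [hx s hs, hu s hs hsU]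
    by_cases hj : j ∈ s <;> simp [hj]
  have hχ := hψ.sub_linear hb
  -- The measure `m n` has no mass below `n`, so the second correction does not disturb the first
  -- one on points.
  have hpt : ∀ k : ℕ, indic 𝔄 {k} ∈ hχ.ker := by
    intro k
    rw [hχ.mem_ker]
    refine nullSeq.sub_mem (hae k) (tendsto_const_nhds.congr' ?_)
    filter_upwards [eventually_gt_atTop k] with n hn
    rw [hbs _ (hsing k) (hUfin _ (finite_singleton k)), massOn, Finsupp.sum]
    refine (Finset.sum_eq_zero fun j hj => Set.indicator_of_notMem ?_ _).symm
    rintro rfl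
    exact Finsupp.mem_support_iff.1 hj (hm2 n j hn)
  have htop : hχ.ker = ⊤ := by
    refine eq_top_of_indic_mem (ℬ := {A ∈ 𝒜 | A ∉ U}) (h𝒜.mono fun A hA => hA.1)
      (fun A hA => hA.1) hUgen hχ.ker hχ.isClosed_ker ?_ hpt fun A hA => ?_
    · have : ∀ n, b n 1 = 0 := fun n => by simp [b, pointCombination_apply]
      simpa only [hχ.mem_ker, this, sub_zero] using ha1
    · by_cases hAinf : A.Infinite
      · have h1 := (hm3 ⟨A, hA.1, hA.2, hAinf⟩).neg
        rw [neg_zero] at h1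
        refine h1.congr fun n => ?_
        rw [neg_sub]
        exact congrArg (ψ (indic 𝔄 A) n - ·) (hbs A (hmem A hA.1) hA.2 n).symm
      · exact indic_mem_of_finite hfin hpt (Set.not_infinite.1 hAinf)
  refine ⟨fun n => a n + b n, C + 2 * (2 * (M + C + 2) + 1), fun n f => ?_, fun f => ?_⟩
  · rw [LinearMap.add_apply, add_mul]
    exact (abs_add_le _ _).trans (add_le_add (ha n f) (hb n f))
  · have hf : f ∈ hχ.ker := by rw [htop]; trivial
    refine (mem_nullSeq.1 hf).congr fun n => ?_
    simp only [ψ, LinearMap.add_apply]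
    ring

/-! ### From lifts to the *extension property -/

theorem UnitBallM.abs_apply_le {K : Type*} [TopologicalSpace K] [CompactSpace K]
    (ν : UnitBallM K) (g : C(K, ℝ)) : |ν.1 g| ≤ ‖g‖ := by
  have h := (WeakDual.toStrongDual ν.1).le_of_opNorm_le ν.2 g
  rwa [one_mul, Real.norm_eq_abs] at h

instance {K : Type*} [TopologicalSpace K] [CompactSpace K] : CompactSpace (UnitBallM K) := by
  have h : {ν : WeakDual ℝ C(K, ℝ) | ‖WeakDual.toStrongDual ν‖ ≤ 1} =
      WeakDual.toStrongDual ⁻¹' Metric.closedBall 0 1 :=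
    Set.ext fun ν => (mem_closedBall_zero_iff (a := WeakDual.toStrongDual ν)).symm
  have hc : IsCompact {ν : WeakDual ℝ C(K, ℝ) | ‖WeakDual.toStrongDual ν‖ ≤ 1} := by
    rw [h]
    exact WeakDual.isCompact_closedBall 0 1
  exact isCompact_iff_compactSpace.1 hc

/-- A function that vanishes on the image of a countable discrete extension and tends to zero along
its complement is continuous. -/
theorem IsCountableDiscreteExtension.continuous_of_finite {L L' : Type*} [TopologicalSpace L]
    [CompactSpace L] [TopologicalSpace L'] [CompactSpace L'] [T2Space L'] {ι : L → L'}
    (hι : IsCountableDiscreteExtension ι) {F : L' → ℝ} (h0 : ∀ ν, F (ι ν) = 0)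
    (hF : ∀ ε > 0, {y | ε ≤ |F y|}.Finite) : Continuous F := by
  have hclosed : IsClosed (range ι) := (isCompact_range hι.isEmbedding.continuous).isClosed
  refine continuous_iff_continuousAt.2 fun y => ?_
  by_cases hy : y ∈ range ι
  · obtain ⟨ν, rfl⟩ := hy
    rw [ContinuousAt, h0, Metric.tendsto_nhds]
    intro ε hε
    have hopen := (hF ε hε).isClosed.isOpen_compl
    filter_upwards [hopen.mem_nhds (show ι ν ∈ _ by simp [h0, hε])] with z hz
    simpa [Real.dist_eq] using hz
  · have h1 : IsOpen ({y} : Set L') := by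
      have := hι.discrete_compl
      have h2 := hclosed.isOpen_compl.isOpenMap_subtype_val _
        (isOpen_discrete ({⟨y, hy⟩} : Set ((range ι)ᶜ : Set L')))
      rwa [Set.image_singleton] at h2
    have h3 : 𝓝 y = pure y := isOpen_singleton_iff_nhds_eq_pure y |>.1 h1
    rw [ContinuousAt, h3]
    exact tendsto_pure_left.2 fun s hs => mem_of_mem_nhds hs

/-- Tietze extensions `G g` depend on `g` nonlinearly, but their defects of linearity vanish on
`M₁(K)` and so tend to zero along the isolated points. Lifting replaces the values of `G g` at those
points by functionals linear in `g`, with an error tending to zero, so continuity survives. -/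
theorem starExtensionProperty_of_hasLifts {K : Type*} [TopologicalSpace K] [CompactSpace K]
    (hK : HasLifts C(K, ℝ)) : StarExtensionProperty K := by
  classical
  intro L' _ _ _ ι hι
  have hclosed : IsClosed (range ι) := (isCompact_range hι.isEmbedding.continuous).isClosed
  have hemb : IsClosedEmbedding ι := ⟨hι.isEmbedding, hclosed⟩
  have hext : ∀ g : C(K, ℝ), ∃ G : C(L', ℝ), (∀ ν, G (ι ν) = ν.1 g) ∧ ∀ y, |G y| ≤ ‖g‖ := by
    intro g
    have hc : Continuous fun ν : UnitBallM K => ν.1 g :=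
      (WeakDual.eval_continuous g).comp continuous_subtype_val
    let f := BoundedContinuousFunction.mkOfCompact ⟨fun ν : UnitBallM K => ν.1 g, hc⟩
    obtain ⟨G, hG1, hG2⟩ :=
      BoundedContinuousFunction.exists_extension_norm_eq_of_isClosedEmbedding f hemb
    refine ⟨G.toContinuousMap, fun ν => congrFun hG2 ν, fun y => (G.norm_coe_le_norm y).trans ?_⟩
    rw [hG1]
    exact (BoundedContinuousFunction.norm_le (norm_nonneg g)).2 fun ν => ν.abs_apply_le g
  choose G hG1 hG2 using hext
  have := hι.countable_compl.to_subtype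
  obtain ⟨e, he⟩ := exists_injective_nat ((range ι)ᶜ : Set L')
  let φ : C(K, ℝ) → ℕ → ℝ := fun g => Function.extend e (fun d => G g d) 0
  have hφe : ∀ g d, φ g (e d) = G g d := fun g d => he.extend_apply _ _ d
  have hφ0 : ∀ g n, (¬ ∃ d, e d = n) → φ g n = 0 := fun g n h => Function.extend_apply' _ _ n h
  have hnull : ∀ H : C(L', ℝ), (∀ ν, H (ι ν) = 0) →
      Function.extend e (fun d => H d) 0 ∈ nullSeq := by
    intro H hH
    rw [mem_nullSeq, ← Nat.cofinite_eq_atTop, Metric.tendsto_nhds]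
    intro ε hε
    -- This set is compact and misses `M₁(K)`, so it is a compact subset of a discrete space and
    -- therefore finite.
    have hcomp : IsCompact {y | ε ≤ |H y|} :=
      (isClosed_le continuous_const H.continuous.abs).isCompact
    have hsub : {y | ε ≤ |H y|} ⊆ (range ι)ᶜ := by
      rintro y hy ⟨ν, rfl⟩
      rw [Set.mem_ofPred_eq, hH, abs_zero] at hy
      exact absurd hy (not_le.2 hε)
    have hfin : {y | ε ≤ |H y|}.Finite := by
      have := hι.discrete_compl
      have h1 : IsCompact ((↑) ⁻¹' {y | ε ≤ |H y|} : Set ((range ι)ᶜ : Set L')) :=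
        IsEmbedding.subtypeVal.isCompact_preimage_iff (by rwa [Subtype.range_coe]) |>.2 hcomp
      have h2 := h1.finite_of_discrete.image ((↑) : ((range ι)ᶜ : Set L') → L')
      rwa [Subtype.image_preimage_coe, Set.inter_eq_right.2 hsub] at h2
    refine ((hfin.preimage Subtype.val_injective.injOn).image e).subset fun n hn => ?_
    simp only [Real.dist_eq, sub_zero, not_lt, Set.mem_compl_iff, Set.mem_ofPred_eq] at hn
    by_cases h : ∃ d, e d = n
    · obtain ⟨d, rfl⟩ := h
      rw [he.extend_apply] at hn
      exact ⟨d, hn, rfl⟩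
    · rw [Function.extend_apply' _ _ n h] at hn
      simp only [Pi.zero_apply, abs_zero] at hn
      exact absurd hn (not_le.2 hε)
  have hφ : IsAsymptoticallyLinear φ 1 :=
    { bound := fun g n => by
        rw [one_mul]
        by_cases h : ∃ d, e d = n
        · obtain ⟨d, rfl⟩ := h
          rw [hφe]
          exact hG2 g d
        · rw [hφ0 g n h, abs_zero]
          exact norm_nonneg g
      add := fun f g => by
        convert hnull (G (f + g) - (G f + G g)) (fun ν => by simp [hG1]) using 1
        ext n
        by_cases h : ∃ d, e d = n
        · obtain ⟨d, rfl⟩ := h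
          simp [hφe, he.extend_apply]
        · simp [hφ0 _ n h, Function.extend_apply' _ _ n h]
      smul := fun c g => by
        convert hnull (G (c • g) - c • G g) (fun ν => by simp [hG1]) using 1
        ext n
        by_cases h : ∃ d, e d = n
        · obtain ⟨d, rfl⟩ := h
          simp [hφe, he.extend_apply]
        · simp [hφ0 _ n h, Function.extend_apply' _ _ n h] }
  obtain ⟨μ, C, hμ, hlim⟩ := hK φ 1 zero_le_one hφ
  let δ : C(K, ℝ) → L' → ℝ := fun g y =>
    if h : y ∈ range ι then 0 else μ (e ⟨y, h⟩) g - G g y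
  have hδι : ∀ g ν, δ g (ι ν) = 0 := fun g ν => dif_pos (mem_range_self ν)
  have hδ : ∀ g, Continuous (δ g) := by
    intro g
    refine hι.continuous_of_finite (hδι g) fun ε hε => ?_
    have h1 := hlim g
    rw [← Nat.cofinite_eq_atTop] at h1
    have h2 : {n | ¬ |φ g n - μ n g| < ε}.Finite := by
      simpa [Real.dist_eq] using (Metric.tendsto_nhds.1 h1) ε hε
    refine ((h2.preimage he.injOn).image ((↑) : ((range ι)ᶜ : Set L') → L')).subset fun y hy => ?_
    by_cases h : y ∈ range ι
    · obtain ⟨ν, rfl⟩ := h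
      rw [Set.mem_ofPred_eq, hδι, abs_zero] at hy
      exact absurd hy (not_le.2 hε)
    · refine ⟨⟨y, h⟩, ?_, rfl⟩
      simp only [Set.mem_ofPred_eq, δ, dif_neg h] at hy
      simp only [Set.mem_preimage, Set.mem_ofPred_eq, hφe, not_lt]
      rwa [abs_sub_comm]
  let E₀ : C(K, ℝ) → C(L', ℝ) := fun g => G g + ⟨δ g, hδ g⟩
  have hEι : ∀ g ν, E₀ g (ι ν) = ν.1 g := fun g ν => by simp [E₀, hδι, hG1]
  have hEd : ∀ g y (h : y ∉ range ι), E₀ g y = μ (e ⟨y, h⟩) g := fun g y h => by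
    change G g y + δ g y = _
    simp only [δ, dif_neg h, add_sub_cancel]
  let E : C(K, ℝ) →ₗ[ℝ] C(L', ℝ) :=
    { toFun := E₀
      map_add' := fun f g => by
        ext y
        by_cases h : y ∈ range ι
        · obtain ⟨ν, rfl⟩ := h
          simp [hEι]
        · simp [hEd _ y h]
      map_smul' := fun c g => by
        ext y
        by_cases h : y ∈ range ι
        · obtain ⟨ν, rfl⟩ := h
          simp [hEι]
        · simp [hEd _ y h] }
  refine ⟨E.mkContinuous (max C 1) fun g => ?_, fun g ν => hEι g ν⟩
  have h1 : (1 : ℝ) ≤ max C 1 := le_max_right _ _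
  refine (ContinuousMap.norm_le _ (by positivity)).2 fun y => ?_
  rw [Real.norm_eq_abs]
  change |E₀ g y| ≤ _
  by_cases h : y ∈ range ι
  · obtain ⟨ν, rfl⟩ := h
    rw [hEι]
    exact (ν.abs_apply_le g).trans (le_mul_of_one_le_left (norm_nonneg g) h1)
  · rw [hEd g y h]
    exact (hμ _ g).trans (mul_le_mul_of_nonneg_right (le_max_left _ _) (norm_nonneg g))

/-! ### From lifts to the splitting of twisted sums -/

theorem abs_apply_le_norm (z : C₀(ℕ, ℝ)) (n : ℕ) : |z n| ≤ ‖z‖ :=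
  z.toBCF.norm_coe_le_norm n

theorem coe_mem_nullSeq (z : C₀(ℕ, ℝ)) : (fun n => z n) ∈ nullSeq := by
  have h := z.zero_at_infty'
  rwa [cocompact_eq_cofinite, Nat.cofinite_eq_atTop] at h

/-- Hahn-Banach: the coordinate functionals of a copy of `c₀` with closed range have uniformly
bounded extensions. -/
theorem exists_coordinate_extensions {X : Type*} [NormedAddCommGroup X] [NormedSpace ℝ X]
    [CompleteSpace X] (i : C₀(ℕ, ℝ) →L[ℝ] X) (hi : Function.Injective i)
    (hclosed : IsClosed (range i)) :
    ∃ (x : ℕ → StrongDual ℝ X) (C : ℝ), 0 ≤ C ∧ (∀ n, ‖x n‖ ≤ C) ∧ ∀ n z, x n (i z) = z n := by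
  -- An injective operator with closed range is bounded below, which gives one constant for all
  -- coordinate functionals.
  obtain ⟨c, hc⟩ := i.antilipschitz_of_injective_of_isClosed_range hi hclosed
  have hbd : ∀ z, ‖z‖ ≤ c * ‖i z‖ := fun z => by
    simpa using hc.le_mul_dist z 0
  let j := LinearEquiv.ofInjective (i : C₀(ℕ, ℝ) →ₗ[ℝ] X) hi
  have hj : ∀ y, i (j.symm y) = y := fun y => by
    conv_rhs => rw [← j.apply_symm_apply y]
    rfl
  have hex : ∀ n, ∃ x : StrongDual ℝ X, ‖x‖ ≤ c ∧ ∀ z, x (i z) = z n := by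
    intro n
    let f : LinearMap.range (i : C₀(ℕ, ℝ) →ₗ[ℝ] X) →ₗ[ℝ] ℝ :=
      { toFun := fun y => j.symm y n
        map_add' := fun y y' => by simp
        map_smul' := fun a y => by simp }
    have hf : ∀ y, ‖f y‖ ≤ c * ‖y‖ := fun y => by
      refine (abs_apply_le_norm (j.symm y) n).trans ((hbd _).trans_eq ?_)
      rw [hj]
      rfl
    obtain ⟨x, hx1, hx2⟩ := exists_extension_norm_eq _ (f.mkContinuous c hf)
    refine ⟨x, hx2.trans_le (LinearMap.mkContinuous_norm_le _ c.2 _), fun z => ?_⟩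
    have h1 := hx1 (j z)
    have h2 : ((j z : LinearMap.range (i : C₀(ℕ, ℝ) →ₗ[ℝ] X)) : X) = i z := rfl
    rw [h2] at h1
    rw [h1]
    exact congrArg (fun w : C₀(ℕ, ℝ) => w n) (j.symm_apply_apply z)
  choose x hx1 hx2 using hex
  exact ⟨x, c, c.2, hx1, hx2⟩

/-- The extended coordinates `x n` map `X` only into `ℓ_∞`, but they map the kernel of `q` into
`c₀`. Hence they induce an operator from `Y` to `ℓ_∞ / c₀`; subtracting a lift of it, composed with
`q`, brings the values into `c₀` without changing them on the range of `i`. -/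
theorem IsTwistedSum.splits_of_hasLifts {X Y : Type*} [NormedAddCommGroup X] [NormedSpace ℝ X]
    [CompleteSpace X] [NormedAddCommGroup Y] [NormedSpace ℝ Y] [CompleteSpace Y]
    (hY : HasLifts Y) {i : C₀(ℕ, ℝ) →L[ℝ] X} {q : X →L[ℝ] Y} (h : IsTwistedSum i q) :
    Splits i := by
  have hclosed : IsClosed (range i) := by
    have h1 : range i = q ⁻¹' {0} := by
      ext y
      exact (h.exact y).symm
    rw [h1]
    exact isClosed_singleton.preimage q.continuous
  obtain ⟨x, C, hC, hx1, hx2⟩ := exists_coordinate_extensions i h.injective hclosed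
  -- The open mapping theorem gives a section `σ` of `q` with a norm bound but no linearity.
  obtain ⟨D, hD, hq⟩ := q.exists_preimage_norm_le h.surjective
  choose σ hσ1 hσ2 using hq
  have hnull : ∀ y, q y = 0 → (fun n => x n y) ∈ nullSeq := by
    intro y hy
    obtain ⟨z, rfl⟩ := (h.exact y).1 hy
    simpa only [hx2] using coe_mem_nullSeq z
  have hφ : IsAsymptoticallyLinear (fun g n => x n (σ g)) (C * D) :=
    { bound := fun g n => by
        have h1 := (x n).le_of_opNorm_le (hx1 n) (σ g)
        rw [Real.norm_eq_abs] at h1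
        rw [mul_assoc]
        exact h1.trans (mul_le_mul_of_nonneg_left (hσ2 g) hC)
      add := fun f g => by
        convert hnull (σ (f + g) - (σ f + σ g)) (by simp [hσ1]) using 1
        ext n
        simp
      smul := fun c g => by
        convert hnull (σ (c • g) - c • σ g) (by simp [hσ1]) using 1
        ext n
        simp }
  obtain ⟨μ, C', hμ, hlim⟩ := hY _ _ (by positivity) hφ
  have hr : ∀ y, (fun n => x n y - μ n (q y)) ∈ nullSeq := by
    intro y
    convert nullSeq.add_mem (hnull (y - σ (q y)) (by simp [hσ1])) (hlim (q y)) using 1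
    ext n
    simp
  let r₀ : X →ₗ[ℝ] C₀(ℕ, ℝ) :=
    { toFun := fun y => ⟨⟨fun n => x n y - μ n (q y), continuous_of_discreteTopology⟩, by
        rw [cocompact_eq_cofinite, Nat.cofinite_eq_atTop]
        exact hr y⟩
      map_add' := fun y y' => by
        ext n
        change x n (y + y') - μ n (q (y + y')) = (x n y - μ n (q y)) + (x n y' - μ n (q y'))
        simp only [map_add]
        ring
      map_smul' := fun c y => by
        ext n
        change x n (c • y) - μ n (q (c • y)) = c * (x n y - μ n (q y))
        simp only [map_smul, smul_eq_mul]
        ring }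
  have hr₀ : ∀ y n, r₀ y n = x n y - μ n (q y) := fun _ _ => rfl
  refine ⟨r₀.mkContinuous (C + |C'| * ‖q‖) fun y => ?_, fun z => ?_⟩
  · change ‖(r₀ y).toBCF‖ ≤ _
    refine (BoundedContinuousFunction.norm_le (by positivity)).2 fun n => ?_
    change |x n y - μ n (q y)| ≤ _
    have h1 := (x n).le_of_opNorm_le (hx1 n) y
    rw [Real.norm_eq_abs] at h1
    have h2 : |μ n (q y)| ≤ |C'| * (‖q‖ * ‖y‖) :=
      (hμ n (q y)).trans (mul_le_mul (le_abs_self C') (q.le_opNorm y) (norm_nonneg _)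
        (abs_nonneg _))
    linarith [abs_sub (x n y) (μ n (q y))]
  · ext n
    change r₀ (i z) n = z n
    rw [hr₀, hx2, (h.exact (i z)).2 ⟨z, rfl⟩, map_zero, sub_zero]

end TwistedSums

theorem corollary5p3 (κ : Cardinal.{0}) (hκ : κ < Cardinal.continuum)
    (hMA : TwistedSums.MartinAxiom κ) (𝒜 : Set (Set ℕ)) (h𝒜 : TwistedSums.AlmostDisjoint 𝒜)
    (hcard : Cardinal.mk 𝒜 = κ) :
    TwistedSums.StarExtensionProperty.{0, v}
        (TwistedSums.StoneSpace (TwistedSums.generatedAlgebra 𝒜)) ∧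
      TwistedSums.AllTwistedSumsTrivial.{0, w}
        (TwistedSums.StoneSpace (TwistedSums.generatedAlgebra 𝒜)) := by
  have h := TwistedSums.hasLifts_stoneSpace hMA h𝒜 hcard.le
  exact ⟨TwistedSums.starExtensionProperty_of_hasLifts h,
    fun X _ _ _ i q hiq => hiq.splits_of_hasLifts h⟩
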